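/- Rows and columns are numbered from $1$. Let $N\ge 0$, and for a partition $\lambda$ let $s_\lambda=s_\lambda(x_1,\dots,x_N)=\sum_T\prod_{e=1}^N x_e^{m(T,e)}$ be its Schur polynomial, where $T$ runs over the semistandard Young tableaux of shape $\lambda$ with entries in $\{1,\dots,N\}$ and $m(T,e)$ is the number of entries of $T$ equal to $e$. A partition is identified with its Ferrers diagram. The *border strip* of $\lambda$ is the set of cells $(a,b)\in\lambda$ with $(a+1,b+1)\notin\lambda$. * $\lambda\!\downarrow\!(a)$ (down-peeling) is obtained from $\lambda$ by removing all cells of the border strip that lie in the rows $a,a+1,\dots$; and $\lambda^-:=\lambda\!\downarrow\!(1)$, i.e. the complete border strip is removed. * For $1\le t\le\lambda_a-\lambda_{a+1}$, $\lambda\!\uparrow\!(a,t)$ (up-peeling) is obtained from $\lambda$ by removing the part of the border strip which starts in the cell of row $a$ and column $\lambda_{a+1}+t$ and extends up to the first row, i.e. all cells of the border strip in rows $\le a$ and columns $\ge\lambda_{a+1}+t$. **Corollary (Gurevich, Pyatov and Saponov).** Let $\lambda=(\lambda_1,\dots,\lambda_r)$ be a partition with $\lambda_r>0$ (or the empty partition,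 $r=0$), let $k\ge 0$, and let $2\le r_1<\dots<r_k\le r$ be indices with $\lambda_{r_i}<\lambda_{r_i-1}$ for $i=1,\dots,k$. Put $r_{k+1}:=r+1$ and choose integers $t_i,m_i$ with $$1\le t_i\le\lambda_{r_i-1}-\lambda_{r_i},\qquad 1\le m_i\le r_{i+1}-r_i\qquad(i=1,\dots,k).$$ Let $\nu$ be obtained from $\lambda$ by adding, for each $i$, the partial border strip with $t_i$ cells in row $r_i$ that spans the $m_i$ rows $r_i,\dots,r_i+m_i-1$; that is, $\nu_{r_i}=\lambda_{r_i}+t_i$, $\nu_{a}=\lambda_{a-1}+1$ for $r_i<a<r_i+m_i$, and $\nu_a=\lambda_a$ for all other rows $a$. Then $\nu$ is a partition and $$s_\lambda\cdot s_{\nu^-}=s_{\lambda^-}\cdot s_\nu+\sum_{i=1}^k s_{\lambda\uparrow(r_i-1,\,t_i)}\cdot s_{\nu\downarrow(r_i)}.$$ -/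

import Mathlib

/-!
Conventions. Partitions are Mathlib's Young diagrams (English notation). Rows and columns are
numbered from `0`, so `lam.rowLen a` is the part `λ_{a+1}`, and `lam.colLen 0` is the length
(the number of nonzero parts) of `lam`.
-/

namespace BorderStrip

/-! ### Schur polynomials -/

/-- The semistandard Young tableaux of shape `lam` with entries in `{0, …, N - 1}`
(a set of `N` consecutive integers). -/
abbrev BoundedSSYT (N : ℕ) (lam : YoungDiagram) : Type :=
  {T : SemistandardYoungTableau lam // ∀ a b : ℕ, (a, b) ∈ lam → T a b < N}

instance finite_boundedSSYT (N : ℕ) (lam : YoungDiagram) : Finite (BoundedSSYT N lam) := by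
  let f : BoundedSSYT N lam → (lam.cells → Fin N) := fun T c =>
    ⟨T.1 c.1.1 c.1.2, T.2 _ _ ((YoungDiagram.mem_cells _).1 c.2)⟩
  refine Finite.of_injective f fun T T' h => ?_
  apply Subtype.ext
  apply SemistandardYoungTableau.ext
  intro a b
  by_cases hab : (a, b) ∈ lam
  · exact congrArg Fin.val (congrFun h ⟨(a, b), (YoungDiagram.mem_cells _).2 hab⟩)
  · rw [T.1.zeros hab, T'.1.zeros hab]

noncomputable instance fintype_boundedSSYT (N : ℕ) (lam : YoungDiagram) :
    Fintype (BoundedSSYT N lam) :=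
  Fintype.ofFinite _

/-- The number of entries of `T` that are equal to `e`. -/
def entryCount {lam : YoungDiagram} (T : SemistandardYoungTableau lam) (e : ℕ) : ℕ :=
  (lam.cells.filter fun c => T c.1 c.2 = e).card

/-- The Schur polynomial of `lam` in `N` variables: the generating function of the semistandard
Young tableaux of shape `lam` with `N` possible entries. -/
noncomputable def schur (N : ℕ) (lam : YoungDiagram) : MvPolynomial (Fin N) ℤ :=
  ∑ T : BoundedSSYT N lam, ∏ e : Fin N, MvPolynomial.X e ^ entryCount T.1 (e : ℕ)

/-! ### Peeling -/

/-- The complete border strip of `lam`: the cells whose diagonal (south-east) neighbour is not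
in `lam`. -/
def rim (lam : YoungDiagram) : Finset (ℕ × ℕ) :=
  lam.cells.filter fun c => (c.1 + 1, c.2 + 1) ∉ lam

theorem mem_rim {lam : YoungDiagram} {c : ℕ × ℕ} :
    c ∈ rim lam ↔ c ∈ lam ∧ (c.1 + 1, c.2 + 1) ∉ lam := by
  simp [rim]

/-- Down-peeling: remove the part of the border strip that begins with the last cell of row `a`
and consists of all its cells in the rows `a, a + 1, …`. -/
def downPeel (lam : YoungDiagram) (a : ℕ) : YoungDiagram where
  cells := lam.cells \ (rim lam).filter fun c => a ≤ c.1
  isLowerSet := by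
    rintro ⟨x, y⟩ ⟨x', y'⟩ ⟨hx, hy⟩ h
    simp only [Finset.coe_sdiff, Set.mem_sdiff, Finset.mem_coe, YoungDiagram.mem_cells,
      Finset.mem_filter, mem_rim, not_and, not_le] at h hx hy ⊢
    refine ⟨lam.up_left_mem hx hy h.1, fun h' => ?_⟩
    by_contra hlt
    have h1 := h.2 ⟨h.1, fun h2 =>
      h'.2 (lam.up_left_mem (Nat.succ_le_succ hx) (Nat.succ_le_succ hy) h2)⟩
    omega

/-- Removal of the complete border strip. -/
def peel (lam : YoungDiagram) : YoungDiagram :=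
  downPeel lam 0

/-- Up-peeling: among the `lam.rowLen a - lam.rowLen (a + 1)` last cells of row `a`, numbered
from left to right by `1, 2, …`, take the one with number `t`, and remove the part of the border
strip that begins there and extends up to the first row.
(Used for `1 ≤ t ≤ lam.rowLen a - lam.rowLen (a + 1)`; that cell is in column
`lam.rowLen (a + 1) + t - 1`.) -/
def upPeel (lam : YoungDiagram) (a t : ℕ) (ht : 1 ≤ t) : YoungDiagram where
  cells := lam.cells \ (rim lam).filter fun c => c.1 ≤ a ∧ lam.rowLen (a + 1) + t - 1 ≤ c.2
  isLowerSet := by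
    rintro ⟨x, y⟩ ⟨x', y'⟩ ⟨hx, hy⟩ h
    simp only [Finset.coe_sdiff, Set.mem_sdiff, Finset.mem_coe, YoungDiagram.mem_cells,
      Finset.mem_filter, mem_rim, not_and, not_le] at h hx hy ⊢
    refine ⟨lam.up_left_mem hx hy h.1, fun h' hxa => ?_⟩
    by_contra hlt
    have h1 := h.2 ⟨h.1, fun h2 =>
      h'.2 (lam.up_left_mem (Nat.succ_le_succ hx) (Nat.succ_le_succ hy) h2)⟩
    have hax : a + 1 ≤ x := by
      by_contra hcon
      have := h1 (by omega)
      omega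
    have h3 := YoungDiagram.mem_iff_lt_rowLen.1 h.1
    have h4 := lam.rowLen_anti _ _ hax
    omega

/-! ### Adding partial border strips -/

/-- The cells of the partial border strip that is added to `lam`, with `t` cells in its first
row `a`, and spanning the `m` rows `a, …, a + m - 1`. In each further row `x` of the strip the
cells added extend up to the column directly below the first cell added in row `x - 1`. -/
def strip (lam : YoungDiagram) (a t m : ℕ) : Finset (ℕ × ℕ) :=
  (Finset.Ico a (a + m)).biUnion fun x =>
    {x} ×ˢ Finset.Ico (lam.rowLen x)
      (if x = a then lam.rowLen a + t else lam.rowLen (x - 1) + 1)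

/-- The row after the block of rows available to the `i`-th strip: the first row of the next
strip, and for the last strip the row just below the diagram. -/
def nextRow (lam : YoungDiagram) {k : ℕ} (r : Fin k → ℕ) (i : Fin k) : ℕ :=
  if h : (i : ℕ) + 1 < k then r ⟨(i : ℕ) + 1, h⟩ else lam.colLen 0

/-- The restrictions on the rows `r i` and on the parameters `t i`, `m i`. -/
structure Admissible (lam : YoungDiagram) {k : ℕ} (r t m : Fin k → ℕ) : Prop where
  strictMono : StrictMono r
  one_le_row : ∀ i, 1 ≤ r i
  row_lt : ∀ i, r i < lam.colLen 0
  rowLen_lt : ∀ i, lam.rowLen (r i) < lam.rowLen (r i - 1)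
  one_le_t : ∀ i, 1 ≤ t i
  t_le : ∀ i, t i ≤ lam.rowLen (r i - 1) - lam.rowLen (r i)
  one_le_m : ∀ i, 1 ≤ m i
  m_le : ∀ i, m i ≤ nextRow lam r i - r i

/-- The diagram obtained from `lam` by adding the `k` partial border strips with `t i` cells in
row `r i` and spanning `m i` rows. -/
def addStrips (lam : YoungDiagram) {k : ℕ} (r t m : Fin k → ℕ) (h : Admissible lam r t m) :
    YoungDiagram where
  cells := lam.cells ∪ Finset.univ.biUnion fun i => strip lam (r i) (t i) (m i)
  isLowerSet := by
    rintro ⟨x, y⟩ ⟨x', y'⟩ ⟨hx, hy⟩ hc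
    simp only [strip, Finset.coe_union, Set.mem_union, Finset.mem_coe, YoungDiagram.mem_cells,
      Finset.mem_biUnion, Finset.mem_univ, true_and, Finset.mem_Ico, Finset.mem_product,
      Finset.mem_singleton] at hc hx hy ⊢
    rcases hc with hc | ⟨i, x0, ⟨hi1, hi2⟩, rfl, hy1, hy2⟩
    · exact Or.inl (lam.up_left_mem hx hy hc)
    · have ht := h.one_le_t i
      have ht' := h.t_le i
      have hr := h.rowLen_lt i
      have hr1 := h.one_le_row i
      by_cases hmem : (x', y') ∈ lam
      · exact Or.inl hmem
      · right
        rw [YoungDiagram.mem_iff_lt_rowLen, not_lt] at hmem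
        by_cases hlt : x' < r i
        · exfalso
          have h1 := lam.rowLen_anti x' (r i - 1) (by omega)
          split_ifs at hy2 with hxr
          · omega
          · have h2 := lam.rowLen_anti (r i) (x - 1) (by omega)
            omega
        · refine ⟨i, x', ⟨by omega, by omega⟩, rfl, hmem, ?_⟩
          by_cases hx1 : x = r i
          · have hx2 : x' = r i := by omega
            rw [if_pos hx1] at hy2
            rw [if_pos hx2]
            omega
          · rw [if_neg hx1] at hy2
            split_ifs with hx2
            · have h3 := lam.rowLen_anti (r i) (x - 1) (by omega)
              omega
            · have h3 := lam.rowLen_anti (x' - 1) (x - 1) (by omega)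
              omega

end BorderStrip

/-!
For a diagram with at most `n + 1` rows, the Jacobi–Trudi formula writes the Schur polynomial as a
determinant of size `n + 1` whose row `i` is `v (rowLen i - i)`, where `v z = (h_z, …, h_{z + n})`
and `h` stands for the complete homogeneous symmetric polynomials. With `n + 1` the number of rows
of `lam`, every diagram in the theorem is thus described by its numbers `l i = rowLen i - i`.

* Adding a strip in the rows `r i, …, r i + m i - 1` removes `l (r i + m i - 1)` from this list and
  inserts `l (r i) + t i` at position `r i`; the numbers between these two places move one row down.
* Peeling the complete border strip deletes the first number, moves the others one row up, and puts
  `-n` last. The matching row `v (-n) = (0, …, 0, 1)` is that of an empty row of a diagram.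
* The partial peelings do the same to an initial or a final segment of the rows.

The theorem is then the exchange identity of Grassmann and Plücker for two determinants
(`det_mul_det_eq_sum_exchange`, a consequence of Cramer's rule), applied to the matrices of `lam` and
`peel nu` with the first row of `lam`, which is also the first row of `nu`, being exchanged. The
exchange with the last row of `peel nu` gives the product for `peel lam` and `nu`; the exchange with
the row `r i - 1`, which is `v (l (r i) + t i)`, gives the `i`-th term of the sum; and each other row
of `peel nu` is already a row of `lam` below the first one, so that its term vanishes
(`rowLen_addStrips_of_ne`). The cyclic permutations that sort the rows of the two factors of a term
have the same sign, so that no signs remain.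

The Jacobi–Trudi formula (`schurEval_eq_det`) is proved by induction on the number of variables.
The tableaux satisfy the branching rule `schurEval_succ`, a sum over the row lengths that interlace
with those of `lam`. On the side of the determinants, subtracting from each row a multiple of the
next one turns it into a sum over the same range of rows in one variable less
(`det_completeSymm_succ`), and multilinearity gives the same sum.
-/

namespace BorderStrip

open Finset

/-! ### Schur polynomials in a commutative ring, and their branching rule -/

/-- The Schur polynomial of `lam` in `N` variables, evaluated at the first `N` terms of a sequence
`x` of elements of a commutative ring. -/
noncomputable def schurEval {R : Type*} [CommRing R] (x : ℕ → R) (N : ℕ) (lam : YoungDiagram) : R :=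
  ∑ T : BoundedSSYT N lam, ∏ c ∈ lam.cells, x (T.1 c.1 c.2)

theorem schur_eq_schurEval (N : ℕ) (lam : YoungDiagram) :
    schur N lam =
      schurEval (fun e => if h : e < N then MvPolynomial.X (⟨e, h⟩ : Fin N) else 0) N lam := by
  refine Finset.sum_congr rfl fun T _ => ?_
  have hmap : ∀ c ∈ lam.cells, T.1 c.1 c.2 ∈ range N := fun c hc =>
    mem_range.2 (T.2 _ _ ((YoungDiagram.mem_cells _).1 hc))
  rw [← Finset.prod_fiberwise_of_maps_to' hmap
    (fun e => if h : e < N then MvPolynomial.X (⟨e, h⟩ : Fin N) else (0 : MvPolynomial (Fin N) ℤ)),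
    Finset.prod_range]
  refine Finset.prod_congr rfl fun e _ => ?_
  rw [Finset.prod_const, dif_pos e.2]
  rfl

theorem rowLen_eq_of_mem_iff {mu : YoungDiagram} {a n : ℕ} (h : ∀ b, (a, b) ∈ mu ↔ b < n) :
    mu.rowLen a = n := by
  apply le_antisymm
  · by_contra hlt
    have := (h n).1 (YoungDiagram.mem_iff_lt_rowLen.2 (by omega))
    omega
  · by_contra hlt
    have := YoungDiagram.mem_iff_lt_rowLen.1 ((h (mu.rowLen a)).2 (by omega))
    omega

theorem rowLen_eq_zero_of_colLen_le {mu : YoungDiagram} {a : ℕ} (h : mu.colLen 0 ≤ a) :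
    mu.rowLen a = 0 := by
  refine rowLen_eq_of_mem_iff fun b => ⟨fun hb => ?_, fun hb => absurd hb (by omega)⟩
  have := YoungDiagram.mem_iff_lt_colLen.1 (mu.up_left_mem le_rfl (Nat.zero_le b) hb)
  omega

/-- The cells of a bounded tableau whose entries are not the largest one allowed. -/
def smallEntries {N : ℕ} {lam : YoungDiagram} (T : BoundedSSYT (N + 1) lam) : YoungDiagram where
  cells := lam.cells.filter fun c => T.1 c.1 c.2 < N
  isLowerSet := by
    rintro ⟨a, b⟩ ⟨a', b'⟩ ⟨ha, hb⟩ h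
    simp only [coe_filter, YoungDiagram.mem_cells, Set.mem_ofPred_eq] at h ha hb ⊢
    refine ⟨lam.up_left_mem ha hb h.1, ?_⟩
    exact ((T.1.row_weak_of_le hb (lam.up_left_mem ha le_rfl h.1)).trans
      (T.1.col_weak ha h.1)).trans_lt h.2

theorem mem_smallEntries {N : ℕ} {lam : YoungDiagram} {T : BoundedSSYT (N + 1) lam} {c : ℕ × ℕ} :
    c ∈ smallEntries T ↔ c ∈ lam ∧ T.1 c.1 c.2 < N := by
  rw [← YoungDiagram.mem_cells]
  simp [smallEntries]

/-- Restriction of a tableau to a diagram that contains only entries smaller than `N`. -/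
def restrictTableau {N : ℕ} {lam mu : YoungDiagram} (hle : mu ≤ lam)
    (T : BoundedSSYT (N + 1) lam) (hT : smallEntries T = mu) : BoundedSSYT N mu :=
  ⟨{ entry := fun a b => if (a, b) ∈ mu then T.1 a b else 0
     row_weak' := by
      intro a b b' hb h
      rw [if_pos h, if_pos (mu.up_left_mem le_rfl hb.le h)]
      exact T.1.row_weak hb (hle h)
     col_strict' := by
      intro a a' b ha h
      rw [if_pos h, if_pos (mu.up_left_mem ha.le le_rfl h)]
      exact T.1.col_strict ha (hle h)
     zeros' := fun h => if_neg h },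
   fun a b h => by
    change (if (a, b) ∈ mu then T.1 a b else 0) < N
    rw [if_pos h]
    rw [← hT] at h
    exact (mem_smallEntries.1 h).2⟩

theorem restrictTableau_apply {N : ℕ} {lam mu : YoungDiagram} (hle : mu ≤ lam)
    (T : BoundedSSYT (N + 1) lam) (hT : smallEntries T = mu) (a b : ℕ) :
    (restrictTableau hle T hT).1 a b = if (a, b) ∈ mu then T.1 a b else 0 := rfl

/-- Extension of a tableau of shape `mu` to the shape `lam` by the entry `N`, where `lam / mu` is a
horizontal strip. -/
def extendTableau {N : ℕ} {lam mu : YoungDiagram} (hle : mu ≤ lam)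
    (hstrip : ∀ a b, (a + 1, b) ∈ lam → (a, b) ∈ mu) (T : BoundedSSYT N mu) :
    BoundedSSYT (N + 1) lam :=
  ⟨{ entry := fun a b => if (a, b) ∈ mu then T.1 a b else if (a, b) ∈ lam then N else 0
     row_weak' := by
      intro a b b' hb h
      have h1 := lam.up_left_mem le_rfl hb.le h
      by_cases h2 : (a, b') ∈ mu
      · rw [if_pos h2, if_pos (mu.up_left_mem le_rfl hb.le h2)]
        exact T.1.row_weak hb h2
      · rw [if_neg h2, if_pos h]
        split_ifs with h3
        · exact (T.2 _ _ h3).le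
        · exact le_rfl
     col_strict' := by
      intro a a' b ha h
      have h1 : (a, b) ∈ mu := hstrip a b (lam.up_left_mem ha le_rfl h)
      rw [if_pos h1]
      by_cases h2 : (a', b) ∈ mu
      · rw [if_pos h2]
        exact T.1.col_strict ha h2
      · rw [if_neg h2, if_pos h]
        exact T.2 _ _ h1
     zeros' := by
      intro a b h
      rw [if_neg fun h' => h (hle h'), if_neg h] },
   fun a b h => by
    change (if (a, b) ∈ mu then T.1 a b else if (a, b) ∈ lam then N else 0) < N + 1
    rw [if_pos h]
    split_ifs with h1
    · exact (T.2 _ _ h1).trans (Nat.lt_succ_self N)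
    · exact Nat.lt_succ_self N⟩

theorem extendTableau_apply {N : ℕ} {lam mu : YoungDiagram} (hle : mu ≤ lam)
    (hstrip : ∀ a b, (a + 1, b) ∈ lam → (a, b) ∈ mu) (T : BoundedSSYT N mu) (a b : ℕ) :
    (extendTableau hle hstrip T).1 a b =
      if (a, b) ∈ mu then T.1 a b else if (a, b) ∈ lam then N else 0 := rfl

theorem smallEntries_extendTableau {N : ℕ} {lam mu : YoungDiagram} (hle : mu ≤ lam)
    (hstrip : ∀ a b, (a + 1, b) ∈ lam → (a, b) ∈ mu) (T : BoundedSSYT N mu) :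
    smallEntries (extendTableau hle hstrip T) = mu := by
  refine SetLike.ext fun c => ?_
  obtain ⟨a, b⟩ := c
  rw [mem_smallEntries, extendTableau_apply]
  by_cases h : (a, b) ∈ mu
  · simp [h, hle h, T.2 _ _ h]
  · by_cases h' : (a, b) ∈ lam <;> simp [h, h']

open Classical in
/-- The tableaux of shape `lam` whose entries smaller than `N` fill `mu` are the tableaux of shape
`mu`, extended by the entry `N`. -/
theorem sum_tableaux_smallEntries_eq {R : Type*} [CommRing R] (x : ℕ → R) (N : ℕ)
    {lam mu : YoungDiagram} (hle : mu ≤ lam) (hstrip : ∀ a b, (a + 1, b) ∈ lam → (a, b) ∈ mu) :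
    ∑ T : BoundedSSYT (N + 1) lam with smallEntries T = mu,
        ∏ c ∈ lam.cells, x (T.1 c.1 c.2) =
      x N ^ (lam.cells \ mu.cells).card * schurEval x N mu := by
  rw [schurEval, Finset.mul_sum]
  refine Finset.sum_bij' (fun T hT => restrictTableau hle T (mem_filter.1 hT).2)
    (fun T _ => extendTableau hle hstrip T) (fun _ _ => mem_univ _)
    (fun T _ => mem_filter.2 ⟨mem_univ _, smallEntries_extendTableau hle hstrip T⟩) ?_ ?_ ?_
  · intro T hT
    apply Subtype.ext
    apply SemistandardYoungTableau.ext
    intro a b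
    rw [extendTableau_apply, restrictTableau_apply]
    split_ifs with h h'
    · rfl
    · have h1 : ¬ (a, b) ∈ smallEntries T := by rwa [(mem_filter.1 hT).2]
      rw [mem_smallEntries] at h1
      have h2 := T.2 _ _ h'
      have h3 : ¬ T.1 a b < N := fun h4 => h1 ⟨h', h4⟩
      omega
    · exact (T.1.zeros h').symm
  · intro T _
    apply Subtype.ext
    apply SemistandardYoungTableau.ext
    intro a b
    rw [restrictTableau_apply, extendTableau_apply]
    split_ifs with h
    · rfl
    · exact (T.1.zeros h).symm
  · intro T hT
    have hsub : mu.cells ⊆ lam.cells := YoungDiagram.cells_subset_iff.2 hle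
    rw [← Finset.prod_sdiff hsub, ← Finset.prod_const]
    congr 1
    · refine Finset.prod_congr rfl fun c hc => ?_
      rw [mem_sdiff, YoungDiagram.mem_cells, YoungDiagram.mem_cells] at hc
      have h1 : ¬ c ∈ smallEntries T := by
        rw [(mem_filter.1 hT).2]
        exact hc.2
      rw [mem_smallEntries] at h1
      have h2 := T.2 _ _ hc.1
      have h3 : ¬ T.1 c.1 c.2 < N := fun h4 => h1 ⟨hc.1, h4⟩
      congr 1
      omega
    · refine Finset.prod_congr rfl fun c hc => ?_
      rw [restrictTableau_apply, if_pos ((YoungDiagram.mem_cells _).1 hc)]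

/-- The diagram whose row lengths are `f 0, …, f (n - 1)`, provided that these interlace with the
row lengths of `lam`. It is defined for every `f`, as the largest diagram inside `lam` whose rows
are no longer than that. -/
def cutRows (lam : YoungDiagram) {n : ℕ} (f : Fin n → ℕ) : YoungDiagram where
  cells := lam.cells.filter fun c => ∀ i : Fin n, (i : ℕ) ≤ c.1 → c.2 < f i
  isLowerSet := by
    rintro ⟨a, b⟩ ⟨a', b'⟩ ⟨ha, hb⟩ h
    simp only [coe_filter, YoungDiagram.mem_cells, Set.mem_ofPred_eq] at h ha hb ⊢
    exact ⟨lam.up_left_mem ha hb h.1, fun i hi => hb.trans_lt (h.2 i (hi.trans ha))⟩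

/-- The possible row lengths of a diagram `mu` inside `lam` such that `lam / mu` is a horizontal
strip. Only the first `n` rows are recorded, where `n` is at least the number of rows of `lam`. -/
def interlacing (lam : YoungDiagram) (n : ℕ) : Finset (Fin n → ℕ) :=
  Fintype.piFinset fun i : Fin n => Finset.Icc (lam.rowLen (i + 1)) (lam.rowLen i)

theorem mem_interlacing {lam : YoungDiagram} {n : ℕ} {f : Fin n → ℕ} :
    f ∈ interlacing lam n ↔ ∀ i : Fin n, lam.rowLen (i + 1) ≤ f i ∧ f i ≤ lam.rowLen i := by
  simp [interlacing]

theorem cutRows_le (lam : YoungDiagram) {n : ℕ} (f : Fin n → ℕ) : cutRows lam f ≤ lam := by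
  intro c hc
  exact (mem_filter.1 ((YoungDiagram.mem_cells _).2 hc)).1

theorem mem_cutRows {lam : YoungDiagram} {n : ℕ} (hn : lam.colLen 0 ≤ n) {f : Fin n → ℕ}
    (hf : f ∈ interlacing lam n) {a b : ℕ} :
    (a, b) ∈ cutRows lam f ↔ ∃ h : a < n, b < f ⟨a, h⟩ := by
  rw [mem_interlacing] at hf
  rw [← YoungDiagram.mem_cells]
  simp only [cutRows, mem_filter, YoungDiagram.mem_cells, YoungDiagram.mem_iff_lt_rowLen]
  constructor
  · rintro ⟨h1, h2⟩
    have h3 : a < n := by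
      by_contra h4
      rw [rowLen_eq_zero_of_colLen_le (by omega)] at h1
      omega
    exact ⟨h3, h2 ⟨a, h3⟩ le_rfl⟩
  · rintro ⟨h, hb⟩
    have h1 := (hf ⟨a, h⟩).2
    refine ⟨hb.trans_le h1, fun i hi => ?_⟩
    rcases hi.eq_or_lt with h2 | h2
    · have h3 : i = ⟨a, h⟩ := Fin.ext h2
      rwa [h3]
    · have h3 := (hf i).1
      have h4 := lam.rowLen_anti (i + 1) a h2
      simp only at h1
      omega

theorem rowLen_cutRows {lam : YoungDiagram} {n : ℕ} (hn : lam.colLen 0 ≤ n) {f : Fin n → ℕ}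
    (hf : f ∈ interlacing lam n) (i : Fin n) : (cutRows lam f).rowLen i = f i :=
  rowLen_eq_of_mem_iff fun b => by simp [mem_cutRows hn hf]

theorem mem_cutRows_of_succ_mem {lam : YoungDiagram} {n : ℕ} (hn : lam.colLen 0 ≤ n)
    {f : Fin n → ℕ} (hf : f ∈ interlacing lam n) {a b : ℕ} (h : (a + 1, b) ∈ lam) :
    (a, b) ∈ cutRows lam f := by
  have h1 := YoungDiagram.mem_iff_lt_colLen.1 (lam.up_left_mem le_rfl (Nat.zero_le b) h)
  rw [mem_cutRows hn hf]
  have h2 : a < n := by omega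
  refine ⟨h2, ?_⟩
  have h3 := (mem_interlacing.1 hf ⟨a, h2⟩).1
  have h4 := YoungDiagram.mem_iff_lt_rowLen.1 h
  exact h4.trans_le h3

theorem card_sdiff_cutRows {lam : YoungDiagram} {n : ℕ} (hn : lam.colLen 0 ≤ n) {f : Fin n → ℕ}
    (hf : f ∈ interlacing lam n) :
    (lam.cells \ (cutRows lam f).cells).card = ∑ i : Fin n, (lam.rowLen i - f i) := by
  have hmem : ∀ a b, (a, b) ∈ lam.cells \ (cutRows lam f).cells ↔
      ∃ h : a < n, f ⟨a, h⟩ ≤ b ∧ b < lam.rowLen a := by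
    intro a b
    rw [mem_sdiff, YoungDiagram.mem_cells, YoungDiagram.mem_cells, mem_cutRows hn hf,
      YoungDiagram.mem_iff_lt_rowLen]
    constructor
    · rintro ⟨h1, h2⟩
      have h3 : a < n := by
        by_contra h4
        rw [rowLen_eq_zero_of_colLen_le (by omega)] at h1
        omega
      exact ⟨h3, not_lt.1 fun h4 => h2 ⟨h3, h4⟩, h1⟩
    · rintro ⟨h1, h2, h3⟩
      exact ⟨h3, fun ⟨_, h4⟩ => absurd h4 (not_lt.2 h2)⟩
  have hset : lam.cells \ (cutRows lam f).cells =
      (univ : Finset (Fin n)).biUnion fun i =>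
        {(i : ℕ)} ×ˢ Finset.Ico (f i) (lam.rowLen i) := by
    ext ⟨a, b⟩
    rw [hmem]
    simp only [mem_biUnion, mem_univ, true_and, mem_product, mem_singleton, mem_Ico]
    constructor
    · rintro ⟨h, h1, h2⟩
      exact ⟨⟨a, h⟩, rfl, h1, h2⟩
    · rintro ⟨i, rfl, h1, h2⟩
      exact ⟨i.2, h1, h2⟩
  rw [hset, card_biUnion]
  · simp
  · intro i _ j _ hij
    rw [Function.onFun, Finset.disjoint_left]
    rintro ⟨a, b⟩ h1 h2
    simp only [mem_product, mem_singleton] at h1 h2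
    exact hij (Fin.ext (h1.1.symm.trans h2.1))

/-- The branching rule: the entries equal to `N` form a horizontal strip. -/
theorem schurEval_succ {R : Type*} [CommRing R] (x : ℕ → R) (N : ℕ) {lam : YoungDiagram} {n : ℕ}
    (hn : lam.colLen 0 ≤ n) :
    schurEval x (N + 1) lam =
      ∑ f ∈ interlacing lam n,
        (∏ i : Fin n, x N ^ (lam.rowLen i - f i)) * schurEval x N (cutRows lam f) := by
  classical
  have hmaps : ∀ T ∈ (univ : Finset (BoundedSSYT (N + 1) lam)),
      (fun i : Fin n => (smallEntries T).rowLen i) ∈ interlacing lam n := by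
    intro T _
    rw [mem_interlacing]
    intro i
    constructor
    · by_contra hlt
      have h1 : ((i : ℕ) + 1, (smallEntries T).rowLen i) ∈ lam :=
        YoungDiagram.mem_iff_lt_rowLen.2 (by omega)
      have h2 := T.2 _ _ h1
      have h3 := T.1.col_strict (Nat.lt_add_one (i : ℕ)) h1
      have h4 : ((i : ℕ), (smallEntries T).rowLen i) ∈ smallEntries T :=
        mem_smallEntries.2 ⟨lam.up_left_mem (Nat.le_succ _) le_rfl h1, by simp only; omega⟩
      exact lt_irrefl _ (YoungDiagram.mem_iff_lt_rowLen.1 h4)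
    · by_contra hlt
      have h1 : ((i : ℕ), lam.rowLen i) ∈ smallEntries T :=
        YoungDiagram.mem_iff_lt_rowLen.2 (by omega)
      exact lt_irrefl _ (YoungDiagram.mem_iff_lt_rowLen.1 (mem_smallEntries.1 h1).1)
  rw [schurEval, ← Finset.sum_fiberwise_of_maps_to hmaps]
  refine Finset.sum_congr rfl fun f hf => ?_
  rw [Finset.prod_pow_eq_pow_sum, ← card_sdiff_cutRows hn hf,
    ← sum_tableaux_smallEntries_eq x N (cutRows_le lam f)
      (fun a b h => mem_cutRows_of_succ_mem hn hf h)]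
  refine Finset.sum_congr (Finset.filter_congr fun T _ => ?_) fun _ _ => rfl
  constructor
  · rintro rfl
    refine SetLike.ext fun ⟨a, b⟩ => ?_
    rw [mem_cutRows hn hf, YoungDiagram.mem_iff_lt_rowLen]
    refine ⟨fun h => ⟨?_, h⟩, fun ⟨_, h⟩ => h⟩
    have h1 := (mem_smallEntries.1 (YoungDiagram.mem_iff_lt_rowLen.2 h)).1
    have h2 := YoungDiagram.mem_iff_lt_colLen.1 (lam.up_left_mem le_rfl (Nat.zero_le b) h1)
    omega
  · intro h
    funext i
    rw [h, rowLen_cutRows hn hf]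

/-- With no entries available, only the empty diagram has a tableau. -/
theorem schurEval_zero {R : Type*} [CommRing R] (x : ℕ → R) (lam : YoungDiagram) :
    schurEval x 0 lam = if lam.rowLen 0 = 0 then 1 else 0 := by
  rw [schurEval]
  split_ifs with h
  · have hempty : ∀ a b, (a, b) ∉ lam := fun a b hab => by
      have := YoungDiagram.mem_iff_lt_rowLen.1 (lam.up_left_mem (Nat.zero_le a) le_rfl hab)
      omega
    have hcells : lam.cells = ∅ := Finset.eq_empty_of_forall_notMem fun c hc =>
      hempty c.1 c.2 ((YoungDiagram.mem_cells _).1 hc)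
    let T₀ : BoundedSSYT 0 lam :=
      ⟨SemistandardYoungTableau.highestWeight lam, fun a b hab => absurd hab (hempty a b)⟩
    have huniq : ∀ T : BoundedSSYT 0 lam, T = T₀ := fun T => by
      apply Subtype.ext
      apply SemistandardYoungTableau.ext
      intro a b
      rw [T.1.zeros (hempty a b), T₀.1.zeros (hempty a b)]
    rw [Fintype.sum_eq_single T₀ fun T hT => absurd (huniq T) hT, hcells, Finset.prod_empty]
  · have : IsEmpty (BoundedSSYT 0 lam) := ⟨fun T =>
      absurd (T.2 0 0 (YoungDiagram.mem_iff_lt_rowLen.2 (by omega))) (Nat.not_lt_zero _)⟩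
    exact Fintype.sum_empty _

/-! ### An exchange identity for determinants -/

theorem det_insertNth {R : Type*} [CommRing R] {n : ℕ} (p : Fin (n + 1)) (u : Fin (n + 1) → R)
    (a : Fin n → Fin (n + 1) → R) :
    Matrix.det (Matrix.of (p.insertNth u a : Fin (n + 1) → Fin (n + 1) → R)) =
      (-1) ^ (p : ℕ) * Matrix.det (Matrix.of (Fin.cons u a : Fin (n + 1) → Fin (n + 1) → R)) := by
  rw [← Fin.cons_comp_cycleRange]
  have h := Matrix.det_permute p.cycleRange
    (Matrix.of (Fin.cons u a : Fin (n + 1) → Fin (n + 1) → R))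
  rw [Fin.sign_cycleRange] at h
  push_cast at h
  exact h

theorem det_insertNth_eq_zero {R : Type*} [CommRing R] {n : ℕ} (p : Fin (n + 1)) {q : Fin n}
    {u : Fin (n + 1) → R} {a : Fin n → Fin (n + 1) → R} (h : u = a q) :
    Matrix.det (Matrix.of (p.insertNth u a : Fin (n + 1) → Fin (n + 1) → R)) = 0 := by
  have hrow : (p.insertNth u a : Fin (n + 1) → Fin (n + 1) → R) p =
      (p.insertNth u a : Fin (n + 1) → Fin (n + 1) → R) (p.succAbove q) := by
    rw [Fin.insertNth_apply_same, Fin.insertNth_apply_succAbove, h]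
  exact Matrix.det_zero_of_row_eq (Fin.succAbove_ne p q).symm hrow

/-- The exchange identity of Grassmann and Plücker: the row `u` of the first determinant is
exchanged with each row of the second one in turn. In each term, both matrices are rearranged so
that the rows `b j` and `u` come to stand at position `j` and at the top, respectively; the two
signs cancel. -/
theorem det_mul_det_eq_sum_exchange {R : Type*} [CommRing R] {n : ℕ} (u : Fin (n + 1) → R)
    (a : Fin n → Fin (n + 1) → R) (b : Fin (n + 1) → Fin (n + 1) → R) :
    Matrix.det (Matrix.of (Fin.cons u a : Fin (n + 1) → Fin (n + 1) → R)) *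
        Matrix.det (Matrix.of b) =
      ∑ j : Fin (n + 1),
        Matrix.det (Matrix.of (j.insertNth (b j) a : Fin (n + 1) → Fin (n + 1) → R)) *
          Matrix.det (Matrix.of (Fin.cons u (j.removeNth b) :
            Fin (n + 1) → Fin (n + 1) → R)) := by
  have hterm : ∀ j : Fin (n + 1),
      Matrix.det (Matrix.of (j.insertNth (b j) a : Fin (n + 1) → Fin (n + 1) → R)) *
          Matrix.det (Matrix.of (Fin.cons u (j.removeNth b) : Fin (n + 1) → Fin (n + 1) → R)) =
        Matrix.det (Matrix.of (Fin.cons (b j) a : Fin (n + 1) → Fin (n + 1) → R)) *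
          Matrix.det ((Matrix.of b).updateRow j u) := by
    intro j
    have h1 := det_insertNth j u (j.removeNth b)
    have h2 : (Matrix.of b).updateRow j u =
        Matrix.of (j.insertNth u (j.removeNth b) : Fin (n + 1) → Fin (n + 1) → R) := by
      rw [Fin.insertNth_removeNth]
      rfl
    rw [det_insertNth, h2, h1]
    ring
  rw [Finset.sum_congr rfl fun j _ => hterm j]
  -- Cramer's rule expresses `det b • u` by the rows of `b`.
  have hcramer : ∑ j, Matrix.det ((Matrix.of b).updateRow j u) • b j =
      Matrix.det (Matrix.of b) • u := by
    have h := Matrix.mulVec_cramer (Matrix.of b).transpose u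
    rw [Matrix.det_transpose] at h
    rw [← h]
    funext k
    simp only [Matrix.mulVec, dotProduct, Matrix.cramer_apply, Finset.sum_apply, Pi.smul_apply,
      smul_eq_mul, Matrix.transpose_apply, Matrix.of_apply]
    refine Finset.sum_congr rfl fun j _ => ?_
    rw [Matrix.updateCol_transpose, Matrix.det_transpose, mul_comm]
  have hcons : ∀ v : Fin (n + 1) → R,
      Matrix.of (Fin.cons v a : Fin (n + 1) → Fin (n + 1) → R) =
        (Matrix.of (Fin.cons u a : Fin (n + 1) → Fin (n + 1) → R)).updateRow 0 v := by
    intro v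
    exact (Fin.update_cons_zero (α := fun _ => Fin (n + 1) → R) u a v).symm
  let D : (Fin (n + 1) → R) →ₗ[R] R :=
    (Matrix.detRowAlternating (n := Fin (n + 1)) (R := R)).toMultilinearMap.toLinearMap
      (Fin.cons u a : Fin (n + 1) → Fin (n + 1) → R) 0
  have hD : ∀ v, D v = Matrix.det (Matrix.of (Fin.cons v a : Fin (n + 1) → Fin (n + 1) → R)) := by
    intro v
    rw [hcons]
    rfl
  have h := congrArg D hcramer
  rw [map_sum] at h
  simp only [map_smul, smul_eq_mul] at h
  simp only [hD] at h
  rw [mul_comm, ← h]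
  exact Finset.sum_congr rfl fun j _ => mul_comm _ _

/-! ### The Jacobi–Trudi formula -/

/-- The complete homogeneous symmetric polynomial of degree `n` in `N` variables, evaluated at the
first `N` terms of `x`. The degree is an integer, so that it can be negative. -/
def completeSymm {R : Type*} [CommRing R] (x : ℕ → R) : ℕ → ℤ → R
  | 0, n => if n = 0 then 1 else 0
  | N + 1, n => ∑ k ∈ range (n.toNat + 1), x N ^ k * completeSymm x N (n - k)

theorem completeSymm_of_neg {R : Type*} [CommRing R] (x : ℕ → R) (N : ℕ) {n : ℤ} (hn : n < 0) :
    completeSymm x N n = 0 := by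
  induction N generalizing n with
  | zero => rw [completeSymm, if_neg hn.ne]
  | succ N ih =>
    rw [completeSymm]
    exact Finset.sum_eq_zero fun k _ => by rw [ih (by omega), mul_zero]

theorem completeSymm_succ {R : Type*} [CommRing R] (x : ℕ → R) (N : ℕ) (n : ℤ) :
    completeSymm x (N + 1) n = completeSymm x N n + x N * completeSymm x (N + 1) (n - 1) := by
  rcases lt_trichotomy n 0 with hn | rfl | hn
  · rw [completeSymm_of_neg x _ hn, completeSymm_of_neg x _ hn, completeSymm_of_neg x _ (by omega)]
    simp
  · rw [completeSymm_of_neg x (N + 1) (n := 0 - 1) (by omega), completeSymm]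
    simp
  · rw [completeSymm, completeSymm, Finset.sum_range_succ', add_comm, Finset.mul_sum]
    have h : (n - 1).toNat + 1 = n.toNat := by omega
    rw [h]
    congr 1
    · simp
    · refine Finset.sum_congr rfl fun k _ => ?_
      rw [pow_succ', mul_assoc]
      congr 3
      push_cast
      ring

/-- The recursion `completeSymm_succ`, telescoped. -/
theorem sum_Icc_completeSymm {R : Type*} [CommRing R] (x : ℕ → R) (N : ℕ) {p q : ℕ} (hpq : p ≤ q)
    (z : ℤ) :
    ∑ m ∈ Finset.Icc p q, x N ^ (q - m) * completeSymm x N (m + z) =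
      completeSymm x (N + 1) (q + z) -
        x N ^ (q + 1 - p) * completeSymm x (N + 1) (p - 1 + z) := by
  induction q, hpq using Nat.le_induction with
  | base =>
    rw [completeSymm_succ x N (p + z)]
    have h : (p : ℤ) + z - 1 = p - 1 + z := by ring
    simp [h]
  | succ q hpq ih =>
    rw [Finset.sum_Icc_succ_top (by omega)]
    have h1 : ∑ m ∈ Finset.Icc p q, x N ^ (q + 1 - m) * completeSymm x N (m + z) =
        x N * ∑ m ∈ Finset.Icc p q, x N ^ (q - m) * completeSymm x N (m + z) := by
      rw [Finset.mul_sum]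
      refine Finset.sum_congr rfl fun m hm => ?_
      rw [Nat.sub_add_comm (Finset.mem_Icc.1 hm).2, pow_succ']
      ring
    have h2 : ((q + 1 : ℕ) : ℤ) + z - 1 = q + z := by push_cast; ring
    rw [h1, ih, completeSymm_succ x N ((q + 1 : ℕ) + z), h2, Nat.sub_add_comm (n := q + 1) (by omega),
      pow_succ', Nat.sub_self, pow_zero]
    ring

theorem colLen_mono {mu lam : YoungDiagram} (h : mu ≤ lam) (j : ℕ) : mu.colLen j ≤ lam.colLen j := by
  by_contra hlt
  have h1 : (lam.colLen j, j) ∈ lam := h (YoungDiagram.mem_iff_lt_colLen.2 (by omega))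
  exact lt_irrefl _ (YoungDiagram.mem_iff_lt_colLen.1 h1)

/-- Row operations on the Jacobi–Trudi matrix in `N + 1` variables: from each row subtract the
multiple of the next one that leaves a sum of rows in `N` variables. -/
theorem det_completeSymm_succ {R : Type*} [CommRing R] (x : ℕ → R) (N : ℕ) {lam : YoungDiagram}
    {n : ℕ} (hn : lam.colLen 0 ≤ n) :
    Matrix.det (Matrix.of fun i j : Fin n => completeSymm x (N + 1) (lam.rowLen i - i + j)) =
      Matrix.det (Matrix.of fun i j : Fin n =>
        ∑ m ∈ Finset.Icc (lam.rowLen (i + 1)) (lam.rowLen i),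
          x N ^ (lam.rowLen i - m) * completeSymm x N (m - i + j)) := by
  let U : Matrix (Fin n) (Fin n) R := Matrix.of fun i k =>
    if k = i then 1
    else if (k : ℕ) = i + 1 then -x N ^ (lam.rowLen i + 1 - lam.rowLen (i + 1)) else 0
  have hU : U.det = 1 := by
    rw [Matrix.det_of_isUpperTriangular]
    · simp [U]
    · intro i k hki
      have h1 : (k : ℕ) < i := hki
      have h2 : k ≠ i := fun h => by omega
      simp only [U, Matrix.of_apply, if_neg h2]
      rw [if_neg (by omega)]
  rw [← one_mul (Matrix.det _), ← hU, ← Matrix.det_mul]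
  congr 1
  ext i j
  have hsum := sum_Icc_completeSymm x N (lam.rowLen_anti i (i + 1) (Nat.le_succ _)) (-i + j)
  simp only [Matrix.mul_apply, Matrix.of_apply]
  have hentry : ∀ m : ℕ, (m : ℤ) - i + j = m + (-i + j) := fun m => by ring
  simp only [hentry]
  rw [hsum]
  by_cases hi : (i : ℕ) + 1 < n
  · have hne : i ≠ ⟨i + 1, hi⟩ := fun h => by
      have := congrArg Fin.val h
      simp only at this
      omega
    rw [Finset.sum_eq_add_of_mem i ⟨i + 1, hi⟩ (mem_univ _) (mem_univ _) hne]
    · simp only [U, Matrix.of_apply, if_true, one_mul, if_neg hne.symm]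
      rw [neg_mul, ← sub_eq_add_neg, hentry]
      congr 3
      push_cast
      ring
    · rintro k - ⟨h1, h2⟩
      have h3 : (k : ℕ) ≠ i + 1 := fun h => h2 (Fin.ext h)
      simp [U, h1, h3]
  · -- The multiple subtracted from the last row is a row of entries of negative degree.
    have h0 : lam.rowLen (i + 1) = 0 := rowLen_eq_zero_of_colLen_le (by omega)
    rw [completeSymm_of_neg x (N + 1) (n := (lam.rowLen (i + 1) : ℤ) - 1 + (-i + j)) (by omega),
      mul_zero, sub_zero]
    rw [Finset.sum_eq_single i]
    · simp [U, hentry]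
    · intro k _ h1
      have h3 : (k : ℕ) ≠ i + 1 := by omega
      simp [U, h1, h3]
    · simp

/-- The Jacobi–Trudi formula, for matrices of any size that is at least the number of rows. By
induction on the number of variables: after the row operations of `det_completeSymm_succ`,
expanding the determinant in its rows gives the sum of the branching rule. -/
theorem schurEval_eq_det {R : Type*} [CommRing R] (x : ℕ → R) (N : ℕ) {lam : YoungDiagram} {n : ℕ}
    (hn : lam.colLen 0 ≤ n) :
    schurEval x N lam =
      Matrix.det (Matrix.of fun i j : Fin n => completeSymm x N (lam.rowLen i - i + j)) := by
  induction N generalizing lam with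
  | zero =>
    rw [schurEval_zero]
    split_ifs with h
    · have hone : (Matrix.of fun i j : Fin n => completeSymm x 0 (lam.rowLen i - i + j)) = 1 := by
        ext i j
        have h1 := lam.rowLen_anti 0 i (Nat.zero_le _)
        rw [Matrix.of_apply, completeSymm, Matrix.one_apply]
        refine if_congr ?_ rfl rfl
        rw [Fin.ext_iff]
        omega
      rw [hone, Matrix.det_one]
    · have hpos : 0 < n := by
        by_contra h1
        exact h (rowLen_eq_zero_of_colLen_le (by omega))
      refine (Matrix.det_eq_zero_of_row_eq_zero ⟨0, hpos⟩ fun j => ?_).symm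
      rw [Matrix.of_apply, completeSymm, if_neg]
      simp only
      omega
  | succ N ih =>
    rw [schurEval_succ x N hn, det_completeSymm_succ x N hn]
    have hmulti := (Matrix.detRowAlternating (n := Fin n) (R := R)).toMultilinearMap.map_sum_finset
      (fun (i : Fin n) (m : ℕ) => x N ^ (lam.rowLen i - m) •
        fun j : Fin n => completeSymm x N (m - i + j))
      (fun i => Finset.Icc (lam.rowLen (i + 1)) (lam.rowLen i))
    have hrows : (Matrix.of fun i j : Fin n =>
        ∑ m ∈ Finset.Icc (lam.rowLen (i + 1)) (lam.rowLen i),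
          x N ^ (lam.rowLen i - m) * completeSymm x N (m - i + j)) =
        Matrix.of fun i : Fin n => ∑ m ∈ Finset.Icc (lam.rowLen (i + 1)) (lam.rowLen i),
          x N ^ (lam.rowLen i - m) • fun j : Fin n => completeSymm x N (m - i + j) := by
      ext i j
      simp
    rw [hrows]
    refine Eq.trans ?_ hmulti.symm
    refine Finset.sum_congr rfl fun f hf => ?_
    rw [MultilinearMap.map_smul_univ, smul_eq_mul, ih ((colLen_mono (cutRows_le lam f) 0).trans hn)]
    simp only [rowLen_cutRows hn hf]
    rfl

/-! ### Row lengths after peeling and after adding strips -/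

theorem downPeel_le (lam : YoungDiagram) (a : ℕ) : downPeel lam a ≤ lam := by
  rw [← YoungDiagram.cells_subset_iff]
  exact Finset.sdiff_subset

theorem upPeel_le (lam : YoungDiagram) (a t : ℕ) (ht : 1 ≤ t) : upPeel lam a t ht ≤ lam := by
  rw [← YoungDiagram.cells_subset_iff]
  exact Finset.sdiff_subset

theorem rowLen_downPeel (lam : YoungDiagram) (a x : ℕ) :
    (downPeel lam a).rowLen x = if a ≤ x then lam.rowLen (x + 1) - 1 else lam.rowLen x := by
  refine rowLen_eq_of_mem_iff fun b => ?_
  have h := lam.rowLen_anti x (x + 1) (Nat.le_succ x)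
  rw [← YoungDiagram.mem_cells]
  simp only [downPeel, mem_sdiff, mem_filter, mem_rim, YoungDiagram.mem_cells,
    YoungDiagram.mem_iff_lt_rowLen]
  split_ifs <;> omega

theorem rowLen_peel (lam : YoungDiagram) (x : ℕ) :
    (peel lam).rowLen x = lam.rowLen (x + 1) - 1 := by
  rw [peel, rowLen_downPeel, if_pos (Nat.zero_le x)]

theorem rowLen_upPeel (lam : YoungDiagram) {a t : ℕ} (ht : 1 ≤ t)
    (hta : t ≤ lam.rowLen a - lam.rowLen (a + 1)) (x : ℕ) :
    (upPeel lam a t ht).rowLen x =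
      if x < a then lam.rowLen (x + 1) - 1
      else if x = a then lam.rowLen (a + 1) + t - 1 else lam.rowLen x := by
  refine rowLen_eq_of_mem_iff fun b => ?_
  have h := lam.rowLen_anti x (x + 1) (Nat.le_succ x)
  rw [← YoungDiagram.mem_cells]
  simp only [upPeel, mem_sdiff, mem_filter, mem_rim, YoungDiagram.mem_cells,
    YoungDiagram.mem_iff_lt_rowLen]
  split_ifs with h1 h2
  · have h3 := lam.rowLen_anti (x + 1) a h1
    omega
  · subst h2
    omega
  · omega

/-- The strips occupy disjoint blocks of rows. -/
theorem Admissible.add_le_row {lam : YoungDiagram} {k : ℕ} {r t m : Fin k → ℕ}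
    (h : Admissible lam r t m) {i j : Fin k} (hij : r i < r j) : r i + m i ≤ r j := by
  have h1 : (i : ℕ) < j := h.strictMono.lt_iff_lt.1 hij
  have h2 : (i : ℕ) + 1 < k := by omega
  have h3 := h.m_le i
  rw [nextRow, dif_pos h2] at h3
  have h4 : r ⟨i + 1, h2⟩ ≤ r j := h.strictMono.monotone (Fin.mk_le_of_le_val h1)
  omega

theorem Admissible.add_le_colLen {lam : YoungDiagram} {k : ℕ} {r t m : Fin k → ℕ}
    (h : Admissible lam r t m) (i : Fin k) : r i + m i ≤ lam.colLen 0 := by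
  have h1 := h.m_le i
  have h2 := h.row_lt i
  rw [nextRow] at h1
  split_ifs at h1 with h3
  · have h4 := h.row_lt ⟨i + 1, h3⟩
    omega
  · omega

theorem mem_addStrips {lam : YoungDiagram} {k : ℕ} {r t m : Fin k → ℕ}
    (h : Admissible lam r t m) {a b : ℕ} :
    (a, b) ∈ addStrips lam r t m h ↔ b < lam.rowLen a ∨ ∃ i, (r i ≤ a ∧ a < r i + m i) ∧
      lam.rowLen a ≤ b ∧ b < if a = r i then lam.rowLen (r i) + t i else lam.rowLen (a - 1) + 1 := by
  rw [← YoungDiagram.mem_cells]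
  simp only [addStrips, strip, mem_union, mem_biUnion, mem_univ, true_and, YoungDiagram.mem_cells,
    YoungDiagram.mem_iff_lt_rowLen, mem_product, mem_singleton, mem_Ico]
  refine or_congr Iff.rfl (exists_congr fun i => ?_)
  constructor
  · rintro ⟨x, hx, rfl, hb⟩
    exact ⟨hx, hb⟩
  · rintro ⟨hx, hb⟩
    exact ⟨a, hx, rfl, hb⟩

theorem rowLen_addStrips_first {lam : YoungDiagram} {k : ℕ} {r t m : Fin k → ℕ}
    (h : Admissible lam r t m) (i : Fin k) :
    (addStrips lam r t m h).rowLen (r i) = lam.rowLen (r i) + t i := by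
  refine rowLen_eq_of_mem_iff fun b => ?_
  rw [mem_addStrips]
  constructor
  · rintro (hb | ⟨j, hj, hb1, hb2⟩)
    · omega
    · have hji : r j = r i := by
        by_contra hne
        have := h.add_le_row (i := j) (j := i) (by omega)
        omega
      rw [if_pos hji.symm, h.strictMono.injective hji] at hb2
      exact hb2
  · intro hb
    have := h.one_le_m i
    by_cases hb1 : b < lam.rowLen (r i)
    · exact Or.inl hb1
    · exact Or.inr ⟨i, ⟨le_rfl, by omega⟩, by omega, by rwa [if_pos rfl]⟩

/-- In terms of the numbers `rowLen a - a`, a row that starts no strip repeats a row of `lam`: the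
same one, or the preceding one. -/
theorem rowLen_addStrips_of_ne {lam : YoungDiagram} {k : ℕ} {r t m : Fin k → ℕ}
    (h : Admissible lam r t m) {a : ℕ} (ha : ∀ i, r i ≠ a) :
    (addStrips lam r t m h).rowLen a = lam.rowLen a ∨
      (∃ i, r i < a) ∧ (addStrips lam r t m h).rowLen a = lam.rowLen (a - 1) + 1 := by
  have hanti := lam.rowLen_anti (a - 1) a (Nat.sub_le a 1)
  by_cases hex : ∃ i, r i ≤ a ∧ a < r i + m i
  · right
    obtain ⟨i, hi⟩ := hex
    refine ⟨⟨i, lt_of_le_of_ne hi.1 (ha i)⟩, rowLen_eq_of_mem_iff fun b => ?_⟩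
    rw [mem_addStrips]
    constructor
    · rintro (hb | ⟨j, -, -, hb⟩)
      · omega
      · rwa [if_neg (ha j).symm] at hb
    · intro hb
      by_cases hb1 : b < lam.rowLen a
      · exact Or.inl hb1
      · exact Or.inr ⟨i, hi, by omega, by rwa [if_neg (ha i).symm]⟩
  · left
    refine rowLen_eq_of_mem_iff fun b => ?_
    rw [mem_addStrips]
    refine ⟨?_, Or.inl⟩
    rintro (hb | ⟨i, hi, -⟩)
    · exact hb
    · exact absurd ⟨i, hi⟩ hex

theorem le_addStrips {lam : YoungDiagram} {k : ℕ} {r t m : Fin k → ℕ}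
    (h : Admissible lam r t m) : lam ≤ addStrips lam r t m h := by
  rw [← YoungDiagram.cells_subset_iff]
  exact Finset.subset_union_left

theorem rowLen_addStrips_zero {lam : YoungDiagram} {k : ℕ} {r t m : Fin k → ℕ}
    (h : Admissible lam r t m) : (addStrips lam r t m h).rowLen 0 = lam.rowLen 0 := by
  rcases rowLen_addStrips_of_ne h (a := 0) fun i => by have := h.one_le_row i; omega with
    h1 | ⟨⟨i, hi⟩, -⟩
  · exact h1
  · omega

theorem colLen_addStrips {lam : YoungDiagram} {k : ℕ} {r t m : Fin k → ℕ}
    (h : Admissible lam r t m) : (addStrips lam r t m h).colLen 0 = lam.colLen 0 := by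
  refine le_antisymm ?_ (colLen_mono (le_addStrips h) 0)
  by_contra hlt
  have h1 : (lam.colLen 0, 0) ∈ addStrips lam r t m h :=
    YoungDiagram.mem_iff_lt_colLen.2 (by omega)
  rw [mem_addStrips, rowLen_eq_zero_of_colLen_le le_rfl] at h1
  rcases h1 with h1 | ⟨i, h1, -⟩
  · omega
  · have := h.add_le_colLen i
    omega

/-! ### The exchange identity for Schur polynomials -/

theorem one_le_rowLen {mu : YoungDiagram} {a : ℕ} (h : a < mu.colLen 0) : 1 ≤ mu.rowLen a :=
  YoungDiagram.mem_iff_lt_rowLen.1 (YoungDiagram.mem_iff_lt_colLen.2 h)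

/-- The row of a Jacobi–Trudi matrix with `n + 1` columns that row `i` of a diagram contributes if
`z` is its length minus `i`. -/
def jacobiTrudiRow {R : Type*} [CommRing R] (x : ℕ → R) (N n : ℕ) (z : ℤ) : Fin (n + 1) → R :=
  fun j => completeSymm x N (z + j)

theorem schurEval_eq_det_rows {R : Type*} [CommRing R] (x : ℕ → R) (N : ℕ) {mu : YoungDiagram}
    {n : ℕ} (hmu : mu.colLen 0 ≤ n + 1) {M : Fin (n + 1) → Fin (n + 1) → R}
    (hM : ∀ i : Fin (n + 1), M i = jacobiTrudiRow x N n (mu.rowLen i - i)) :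
    Matrix.det (Matrix.of M) = schurEval x N mu := by
  rw [schurEval_eq_det x N hmu]
  congr 1
  ext i j
  rw [Matrix.of_apply, hM i]
  rfl

/-- The first factor of a term of the exchange identity: the first row of the matrix of `lam` is
deleted, which shifts the rows above position `p` and lowers their parts by one, as peeling does,
and a new row is put at position `p`. -/
theorem det_insertNth_eq_schurEval {R : Type*} [CommRing R] (x : ℕ → R) (N : ℕ)
    {lam mu : YoungDiagram} {n : ℕ} (hlam : lam.colLen 0 = n + 1) (hmu : mu ≤ lam)
    (p : Fin (n + 1)) (hlt : ∀ i < (p : ℕ), mu.rowLen i = lam.rowLen (i + 1) - 1)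
    (hgt : ∀ i > (p : ℕ), mu.rowLen i = lam.rowLen i) :
    Matrix.det (Matrix.of (p.insertNth (jacobiTrudiRow x N n (mu.rowLen p - p))
      (fun i : Fin n => jacobiTrudiRow x N n (lam.rowLen (i + 1) - (i + 1))) :
        Fin (n + 1) → Fin (n + 1) → R)) = schurEval x N mu := by
  refine schurEval_eq_det_rows x N ((colLen_mono hmu 0).trans hlam.le) fun i => ?_
  induction i using Fin.succAboveCases p with
  | x => rw [Fin.insertNth_apply_same]
  | p i =>
    rw [Fin.insertNth_apply_succAbove]
    congr 1
    rcases lt_or_ge i.castSucc p with h | h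
    · have h1 := one_le_rowLen (mu := lam) (a := i + 1) (by omega)
      rw [Fin.succAbove_of_castSucc_lt _ _ h, Fin.val_castSucc, hlt i h]
      omega
    · rw [Fin.succAbove_of_le_castSucc _ _ h, Fin.val_succ, hgt (i + 1) (Nat.lt_succ_of_le h)]
      push_cast
      ring

/-- The second factor of a term of the exchange identity: row `p` of the matrix of `peel nu` is
replaced by the first row of `nu` and moved to the top, which undoes the peeling above that row. -/
theorem det_cons_removeNth_eq_schurEval {R : Type*} [CommRing R] (x : ℕ → R) (N : ℕ)
    {nu mu : YoungDiagram} {n : ℕ} (hnu : nu.colLen 0 = n + 1) (hmu : mu ≤ nu)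
    (p : Fin (n + 1)) (hle : ∀ i ≤ (p : ℕ), mu.rowLen i = nu.rowLen i)
    (hgt : ∀ i > (p : ℕ), mu.rowLen i = nu.rowLen (i + 1) - 1) :
    Matrix.det (Matrix.of (Fin.cons (jacobiTrudiRow x N n (nu.rowLen 0))
      (p.removeNth fun i : Fin (n + 1) => jacobiTrudiRow x N n ((peel nu).rowLen i - i)) :
        Fin (n + 1) → Fin (n + 1) → R)) = schurEval x N mu := by
  refine schurEval_eq_det_rows x N ((colLen_mono hmu 0).trans hnu.le) fun i => ?_
  refine Fin.cases ?_ (fun i => ?_) i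
  · rw [Fin.cons_zero, Fin.val_zero, hle 0 (Nat.zero_le _)]
    simp
  · rw [Fin.cons_succ, Fin.removeNth_apply, rowLen_peel]
    congr 1
    rcases lt_or_ge i.castSucc p with h | h
    · have h1 := one_le_rowLen (mu := nu) (a := i + 1) (by omega)
      rw [Fin.succAbove_of_castSucc_lt _ _ h, Fin.val_castSucc, Fin.val_succ, hle (i + 1) h]
      omega
    · rw [Fin.succAbove_of_le_castSucc _ _ h, Fin.val_succ, hgt (i + 1) (Nat.lt_succ_of_le h)]

/-- The identity for the Schur polynomials evaluated in a commutative ring. In the exchange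
identity for the Jacobi–Trudi determinants of `lam` and `peel nu`, the last term is the product of
`peel lam` and `nu`, the terms of the rows `r i - 1` are the products in the sum, and the other
terms have two equal rows. -/
theorem schurEval_mul_schurEval_peel_addStrips {R : Type*} [CommRing R] (x : ℕ → R) (N : ℕ)
    (lam : YoungDiagram) {k : ℕ} (r t m : Fin k → ℕ) (h : Admissible lam r t m) :
    schurEval x N lam * schurEval x N (peel (addStrips lam r t m h)) =
      schurEval x N (peel lam) * schurEval x N (addStrips lam r t m h) +
        ∑ i : Fin k, schurEval x N (upPeel lam (r i - 1) (t i) (h.one_le_t i)) *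
          schurEval x N (downPeel (addStrips lam r t m h) (r i)) := by
  have hnu0 := rowLen_addStrips_zero h
  have hnuc := colLen_addStrips h
  have hfirst := rowLen_addStrips_first h
  have hother := fun a => rowLen_addStrips_of_ne h (a := a)
  generalize addStrips lam r t m h = nu at hnu0 hnuc hfirst hother ⊢
  rcases hc : lam.colLen 0 with _ | n
  · have hk : IsEmpty (Fin k) := ⟨fun i => by have := h.row_lt i; omega⟩
    have hempty : ∀ mu : YoungDiagram, mu.colLen 0 = 0 → mu = ⊥ := fun mu hmu =>
      SetLike.ext fun c => ⟨fun hc => by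
        have := YoungDiagram.mem_iff_lt_colLen.1
          (mu.up_left_mem (le_refl c.1) (Nat.zero_le c.2) hc)
        omega, fun hc => absurd hc (YoungDiagram.notMem_bot c)⟩
    rw [Fintype.sum_empty, add_zero, hempty lam hc, hempty nu (hnuc.trans hc), mul_comm]
  rw [hc] at hnuc
  have hexch := det_mul_det_eq_sum_exchange (jacobiTrudiRow x N n (nu.rowLen 0))
    (fun i : Fin n => jacobiTrudiRow x N n (lam.rowLen (i + 1) - (i + 1)))
    (fun i : Fin (n + 1) => jacobiTrudiRow x N n ((peel nu).rowLen i - i))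
  have hleft : Matrix.det (Matrix.of (Fin.cons (jacobiTrudiRow x N n (nu.rowLen 0))
      (fun i : Fin n => jacobiTrudiRow x N n (lam.rowLen (i + 1) - (i + 1))) :
        Fin (n + 1) → Fin (n + 1) → R)) = schurEval x N lam := by
    refine schurEval_eq_det_rows x N hc.le fun i => ?_
    refine Fin.cases ?_ (fun i => ?_) i
    · rw [Fin.cons_zero, hnu0]
      simp
    · rw [Fin.cons_succ]
      simp
  have hpeel : (peel nu).colLen 0 ≤ n + 1 := (colLen_mono (downPeel_le nu 0) 0).trans hnuc.le
  rw [hleft, schurEval_eq_det_rows x N hpeel fun _ => rfl, Fin.sum_univ_castSucc] at hexch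
  refine (hexch.trans (add_comm _ _)).trans ?_
  congr 1
  · rw [det_cons_removeNth_eq_schurEval x N hnuc le_rfl (Fin.last n) (fun _ _ => rfl)]
    · congr 1
      have hrow : (peel nu).rowLen (Fin.last n) = (peel lam).rowLen (Fin.last n) := by
        rw [rowLen_peel, rowLen_peel, Fin.val_last, rowLen_eq_zero_of_colLen_le hnuc.le,
          rowLen_eq_zero_of_colLen_le hc.le]
      rw [hrow]
      refine det_insertNth_eq_schurEval x N hc (mu := peel lam) (downPeel_le lam 0) (Fin.last n)
        (fun i _ => rowLen_peel lam i) fun i hi => ?_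
      rw [Fin.val_last] at hi
      rw [rowLen_peel, rowLen_eq_zero_of_colLen_le (by omega),
        rowLen_eq_zero_of_colLen_le (by omega)]
    · intro i hi
      rw [Fin.val_last] at hi
      rw [rowLen_eq_zero_of_colLen_le (by omega), rowLen_eq_zero_of_colLen_le (by omega)]
  · symm
    have hrn : ∀ i, r i - 1 < n := fun i => by
      have h1 := h.row_lt i
      have h2 := h.one_le_row i
      omega
    refine Finset.sum_of_injOn (fun i : Fin k => (⟨r i - 1, hrn i⟩ : Fin n)) ?_ (by simp) ?_ ?_
    · intro i _ j _ hij
      have h1 := congrArg Fin.val hij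
      have h2 := h.one_le_row i
      have h3 := h.one_le_row j
      simp only at h1
      exact h.strictMono.injective (by omega)
    · -- In a row that starts no strip, the part of `nu` repeats a row of the matrix of `lam`.
      intro j _ hj
      have hj' : ∀ i, r i ≠ j + 1 := fun i hi =>
        hj ⟨i, by simp, Fin.ext (by simp only; omega)⟩
      have hpos := one_le_rowLen (mu := nu) (a := j + 1) (by omega)
      obtain ⟨q, hq⟩ : ∃ q : Fin n, ((peel nu).rowLen j : ℤ) - j = lam.rowLen (q + 1) - (q + 1) := by
        rw [rowLen_peel]
        rcases hother _ hj' with h1 | ⟨⟨i, hi⟩, h1⟩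
        · exact ⟨j, by omega⟩
        · have h2 := h.one_le_row i
          refine ⟨⟨j - 1, by omega⟩, ?_⟩
          have h3 : (j : ℕ) - 1 + 1 = j := by omega
          simp only [h3]
          rw [h1, Nat.add_sub_cancel, Nat.add_sub_cancel]
          omega
      rw [det_insertNth_eq_zero (q := q) _ (congrArg (jacobiTrudiRow x N n) hq), zero_mul]
    · intro i _
      have h1 := h.one_le_row i
      have h2 : r i - 1 + 1 = r i := by omega
      have h3 := h.one_le_t i
      have hup := rowLen_upPeel lam (a := r i - 1) h3 (by rw [h2]; exact h.t_le i)
      rw [det_cons_removeNth_eq_schurEval x N hnuc (downPeel_le nu (r i))]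
      · congr 1
        have hrow : (peel nu).rowLen (Fin.castSucc (⟨r i - 1, hrn i⟩ : Fin n)) =
            (upPeel lam (r i - 1) (t i) h3).rowLen
              (Fin.castSucc (⟨r i - 1, hrn i⟩ : Fin n)) := by
          rw [Fin.val_castSucc, rowLen_peel, hup, if_neg (lt_irrefl _), if_pos rfl, h2, hfirst]
        rw [hrow]
        refine (det_insertNth_eq_schurEval x N hc (upPeel_le _ _ _ _) _ ?_ ?_).symm
        · intro a ha
          have ha' : a < r i - 1 := ha
          rw [hup, if_pos ha']
        · intro a ha
          have ha' : r i - 1 < a := ha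
          rw [hup, if_neg (by omega), if_neg (by omega)]
      · intro a ha
        have ha' : a ≤ r i - 1 := ha
        rw [rowLen_downPeel, if_neg (by omega)]
      · intro a ha
        have ha' : r i - 1 < a := ha
        rw [rowLen_downPeel, if_pos (by omega)]

end BorderStrip

theorem mainTheorem3 (N : ℕ) (lam : YoungDiagram) {k : ℕ} (r t m : Fin k → ℕ)
    (h : BorderStrip.Admissible lam r t m) (nu : YoungDiagram)
    (hnu : nu = BorderStrip.addStrips lam r t m h) :
    BorderStrip.schur N lam * BorderStrip.schur N (BorderStrip.peel nu) =
      BorderStrip.schur N (BorderStrip.peel lam) * BorderStrip.schur N nu +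
        ∑ i : Fin k,
          BorderStrip.schur N (BorderStrip.upPeel lam (r i - 1) (t i) (h.one_le_t i)) *
            BorderStrip.schur N (BorderStrip.downPeel nu (r i)) := by
  subst hnu
  simp only [BorderStrip.schur_eq_schurEval]
  exact BorderStrip.schurEval_mul_schurEval_peel_addStrips _ N lam r t m h
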